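/- Let $(R,\mathfrak m)$ be a one-dimensional Noetherian local domain with field of quotients $Q$ and residue field $k=R/\mathfrak m$. Assume that $R$ is analytically irreducible, i.e. that its integral closure $\overline R$ in $Q$ is a discrete valuation ring and a finitely generated $R$-module; the residue field of $\overline R$ may be larger than $k$. Write $\ell$ for the length of $R$-modules and, for $R$-submodules $\mathfrak a,\mathfrak b$ of $Q$, put $\mathfrak a:\mathfrak b=\{x\in Q : x\mathfrak b\subseteq\mathfrak a\}$ and $\mathfrak a^{-1}=R:\mathfrak a$. Let $v$ be the normalized valuation of $\overline R$, $X$ a generator of the maximal ideal of $\overline R$, and $$v(R)=\{v(a): a\in R,\ a\ne 0\}=\{s_0=0<s_1<s_2<\cdots\},$$ where $s_r$ is the least integer $c$ such that every integer $n\ge c$ lies in $v(R)$. Let $C=R:\overline R=X^N\overline R$ and write $N=s_r+l=s_{r+l}$ with $l\ge 0$. For $i\ge 0$ put $$\mathfrak a_i=\{x\in R: v(x)\ge s_i\},\qquad n_i=\dim_k(\mathfrak a_i/\mathfrak a_{i+1}).$$ Let $t(R)=\ell(\mathfrak m^{-1}/R)$ be the Cohen–Macaulay type of $R$. The type sequence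 of $R$ is $(t_1,\dots,t_{r+l})$, where $t_i=\ell(\mathfrak a_i^{-1}/\mathfrak a_{i-1}^{-1})$. The ring $R$ is called almost Gorenstein if $\ell(\overline R/R)=\ell(R/C)+t(R)-1$, and of maximal length if $\ell(\overline R/R)=t(R)\,\ell(R/C)$. Theorem. (1) $R$ is almost Gorenstein if and only if its type sequence is $(t(R),n_1,n_2,\dots,n_{r+l-1})$. (2) $R$ is of maximal length if and only if its type sequence is $(t(R),t(R)n_1,t(R)n_2,\dots,t(R)n_{r+l-1})$. (If $R=\overline R$, then $r+l=0$ and all the sequences above are understood to be empty.) -/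

import Mathlib

open IsLocalRing
open scoped Pointwise

section

universe u v

variable (R : Type u) (Q : Type v) [CommRing R] [IsDomain R] [Field Q] [Algebra R Q]
  [IsFractionRing R Q]

/-- The integral closure of `R` in its field of quotients `Q` is a discrete valuation ring and
a finitely generated `R`-module. -/
class AnalyticallyIrreducible : Prop where
  isDVR : IsDiscreteValuationRing (integralClosure R Q)
  finite : Module.Finite R (integralClosure R Q)

attribute [instance] AnalyticallyIrreducible.isDVR AnalyticallyIrreducible.finite

variable {R Q} in
/-- The length `ℓ_R(F / E)`, for `R`-submodules `E ⊆ F` of `Q`. -/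
noncomputable def quotLength (F E : Submodule R Q) : ℕ∞ :=
  Module.length R (F ⧸ E.submoduleOf F)

/-- The integral closure of `R`, as an `R`-submodule of `Q`. -/
noncomputable def intClosure : Submodule R Q :=
  Subalgebra.toSubmodule (integralClosure R Q)

/-- The conductor `C = R : intClosure`. The submodule `1` is the image of `R` in `Q`, and `E / F`
is the colon `E : F = {x ∈ Q | x F ⊆ E}`. -/
noncomputable def conductorModule : Submodule R Q :=
  1 / intClosure R Q

/-- The inverse `R : I = {x ∈ Q | x I ⊆ R}` of an ideal `I` of `R`. -/
noncomputable def idealInv (I : Ideal R) : Submodule R Q :=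
  1 / IsLocalization.coeSubmodule Q I

/-- The Cohen-Macaulay type `t(R) = ℓ_R(𝔪⁻¹ / R)`. -/
noncomputable def cmType [IsLocalRing R] : ℕ∞ :=
  quotLength (idealInv R Q (maximalIdeal R)) 1

/-- `R` is almost Gorenstein if `ℓ_R(intClosure / R)` has its minimal possible value
`ℓ_R(R / C) + t(R) - 1`. -/
def IsAlmostGorenstein [IsLocalRing R] : Prop :=
  quotLength (intClosure R Q) 1 + 1 = quotLength 1 (conductorModule R Q) + cmType R Q

/-- `R` is of maximal length if `ℓ_R(intClosure / R) = t(R) ℓ_R(R / C)`. -/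
def IsOfMaximalLength [IsLocalRing R] : Prop :=
  quotLength (intClosure R Q) 1 = cmType R Q * quotLength 1 (conductorModule R Q)

variable [AnalyticallyIrreducible R Q]

/-- The normalized valuation of the discrete valuation ring `integralClosure R Q`, restricted to
`R`, with `v(0) = ⊤`. -/
noncomputable def ordVal (x : R) : ℕ∞ :=
  IsDiscreteValuationRing.addVal (integralClosure R Q) (algebraMap R (integralClosure R Q) x)

/-- The semigroup of values `v(R) = {v(a) | a ∈ R, a ≠ 0}`. -/
def valueSet : Set ℕ := {n | ∃ a : R, a ≠ 0 ∧ ordVal R Q a = n}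

/-- `s_i`: the elements of `v(R)` in increasing order, starting with `s_0`. -/
noncomputable def valueAt (i : ℕ) : ℕ := Nat.nth (· ∈ valueSet R Q) i

/-- The ideal `𝔞_i = {x ∈ R | v(x) ≥ s_i}`. -/
noncomputable def valueIdeal (i : ℕ) : Ideal R where
  carrier := {x | (valueAt R Q i : ℕ∞) ≤ ordVal R Q x}
  zero_mem' := by simp [ordVal]
  add_mem' {x y} hx hy := by
    simp only [Set.mem_ofPred_eq, ordVal, map_add] at *
    exact le_trans (le_min hx hy) (AddValuation.map_add _ _ _)
  smul_mem' a x hx := by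
    simp only [Set.mem_ofPred_eq, ordVal, smul_eq_mul, map_mul, AddValuation.map_mul] at *
    exact le_trans hx le_add_self

/-- `(t_1, …, t_m)` with `t_i = ℓ_R(𝔞_i⁻¹ / 𝔞_{i-1}⁻¹)`; the entry `t_i` has index `i - 1`. For
`m = r + l` this is the type sequence of `R`. -/
noncomputable def typeSequence (m : ℕ) : Fin m → ℕ∞ := fun j =>
  quotLength (idealInv R Q (valueIdeal R Q (j + 1))) (idealInv R Q (valueIdeal R Q j))

/-- The quotient `𝔞_i / 𝔞_{i+1}`. -/
abbrev valueQuot (i : ℕ) : Type u :=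
  valueIdeal R Q i ⧸ (valueIdeal R Q (i + 1)).submoduleOf (valueIdeal R Q i)

variable [IsLocalRing R]

theorem mul_mem_valueIdeal_succ {i : ℕ} {x y : R} (hx : x ∈ maximalIdeal R)
    (hy : y ∈ valueIdeal R Q i) : x * y ∈ valueIdeal R Q (i + 1) := by
  have hpos : 1 ≤ ordVal R Q x := by
    rw [Order.one_le_iff_pos, pos_iff_ne_zero]
    intro h0
    have hu : IsUnit (algebraMap R (integralClosure R Q) x) :=
      IsDiscreteValuationRing.addVal_eq_zero_iff.mp h0
    exact (mem_maximalIdeal x).mp hx (isUnit_of_map_unit _ _ hu)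
  have hy' : (valueAt R Q i : ℕ∞) ≤ ordVal R Q y := hy
  have hmul : ordVal R Q (x * y) = ordVal R Q x + ordVal R Q y := by
    simp [ordVal]
  change (valueAt R Q (i + 1) : ℕ∞) ≤ ordVal R Q (x * y)
  cases hv : ordVal R Q (x * y) with
  | top => exact le_top
  | coe n =>
    have hn : n ∈ valueSet R Q := by
      refine ⟨x * y, ?_, hv⟩
      intro h0
      simp [h0, ordVal] at hv
    have hlt : valueAt R Q i < n := by
      have h1 : ((1 + valueAt R Q i : ℕ) : ℕ∞) ≤ n := by
        rw [← hv, hmul]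
        push_cast
        exact add_le_add hpos hy'
      have := Nat.cast_le.mp h1
      omega
    refine Nat.cast_le.mpr ?_
    by_contra hcon
    push Not at hcon
    exact absurd (Nat.le_nth_of_lt_nth_succ hcon hn) (not_le.mpr hlt)

theorem valueQuot_isTorsionBySet (i : ℕ) :
    Module.IsTorsionBySet R (valueQuot R Q i) (maximalIdeal R) := by
  rintro z ⟨x, hx⟩
  obtain ⟨y, rfl⟩ := Submodule.Quotient.mk_surjective _ z
  change Submodule.Quotient.mk (x • y) = 0
  rw [Submodule.Quotient.mk_eq_zero]
  exact mul_mem_valueIdeal_succ R Q hx y.2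

/-- Since `𝔪 𝔞_i ⊆ 𝔞_{i+1}`, the quotient `𝔞_i / 𝔞_{i+1}` is a vector space over the residue
field `k` of `R`. -/
noncomputable instance valueQuotModule (i : ℕ) : Module (ResidueField R) (valueQuot R Q i) :=
  (valueQuot_isTorsionBySet R Q i).module

/-- `n_i = dim_k(𝔞_i / 𝔞_{i+1})`. -/
noncomputable def valueDim (i : ℕ) : ℕ :=
  Module.finrank (ResidueField R) (valueQuot R Q i)

end

/-! Write m = r + l, so that s_m = N. The chain R = 𝔞_0 ⊃ ... ⊃ 𝔞_m = C gives ℓ(R/C) = n_0 + ... +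
n_{m-1}. Its chain of inverses rises from R to R : C = R̄, which gives ℓ(R̄/R) = t_1 + ... + t_m. If
m > 0, then 𝔞_1 = 𝔪 gives t_1 = t(R) and n_0 = 1, and everything rests on the bounds n_i ≤ t_{i+1} ≤
t(R) n_i for i < m. Almost Gorenstein says that the t_{i+1} with i ≥ 1 have the same sum as their
lower bounds, maximal length that they have the same sum as their upper bounds. All terms are
finite, so equal sums mean equal terms.

Upper bound (`quotLength_idealInv_le`): multiplication by lifts of a k-basis of 𝔞_i/𝔞_{i+1} embeds
𝔞_{i+1}⁻¹/𝔞_i⁻¹ into n_i copies of 𝔪⁻¹/R.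

Lower bound (`valueDim_le_quotLength`): let K be the residue field of R̄. Since C is exactly X^N R̄,
the leading coefficients of elements of R of value at least N - 1 do not fill K, so a nonzero
k-functional φ on K kills them. Pairing X^(N-1-s_i) R̄ with 𝔞_i through φ of the coefficient of
X^(N-1) produces every functional on 𝔞_i/𝔞_{i+1}, while elements of 𝔞_i⁻¹ produce zero. -/

/-! ### Lengths of quotients of submodules of Q, and inverses of ideals -/

section QuotLength

variable {R : Type*} {Q : Type*} [CommRing R] [Field Q] [Algebra R Q]
  {M D : Type*} [AddCommGroup M] [Module R M] [AddCommGroup D] [Module R D]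

theorem quotLength_add {E F G : Submodule R Q} (hEF : E ≤ F) (hFG : F ≤ G) :
    quotLength G E = quotLength F E + quotLength G F := by
  refine Module.length_eq_add_of_exact
    (Submodule.mapQ (E.submoduleOf F) (E.submoduleOf G) (Submodule.inclusion hFG) (fun _ h => Submodule.mem_comap.mpr h))
    (Submodule.mapQ (E.submoduleOf G) (F.submoduleOf G) LinearMap.id (fun _ h => Submodule.mem_comap.mpr (hEF h))) ?_ ?_ ?_
  · rw [← LinearMap.ker_eq_bot, LinearMap.ker_eq_bot']
    intro z hz
    obtain ⟨x, rfl⟩ := Submodule.Quotient.mk_surjective _ z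
    rw [Submodule.mapQ_apply, Submodule.Quotient.mk_eq_zero] at hz
    rwa [Submodule.Quotient.mk_eq_zero]
  · intro z
    obtain ⟨x, rfl⟩ := Submodule.Quotient.mk_surjective _ z
    exact ⟨Submodule.Quotient.mk x, rfl⟩
  · intro z
    obtain ⟨x, rfl⟩ := Submodule.Quotient.mk_surjective _ z
    rw [Submodule.mapQ_apply, Submodule.Quotient.mk_eq_zero]
    constructor
    · intro hx
      exact ⟨Submodule.Quotient.mk ⟨x, hx⟩, rfl⟩
    · rintro ⟨w, hw⟩
      obtain ⟨y, rfl⟩ := Submodule.Quotient.mk_surjective _ w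
      rw [Submodule.mapQ_apply, Submodule.Quotient.eq] at hw
      have h : (y : Q) - x ∈ F := hEF hw
      exact (Submodule.sub_mem_iff_right _ y.2).mp h

theorem quotLength_self (E : Submodule R Q) : quotLength E E = 0 := by
  rw [quotLength, Module.length_eq_zero_iff, Submodule.submoduleOf_self]
  infer_instance

theorem quotLength_eq_length_quotient (E : Submodule R Q) (φ : M →ₗ[R] Q) :
    quotLength (LinearMap.range φ) E = Module.length R (M ⧸ E.comap φ) := by
  have hk : E.comap φ = LinearMap.ker
      ((E.submoduleOf (LinearMap.range φ)).mkQ ∘ₗ φ.rangeRestrict) := by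
    rw [LinearMap.ker_comp, Submodule.ker_mkQ]
    rfl
  rw [hk]
  exact (LinearMap.quotKerEquivOfSurjective _
    (by
      rw [LinearMap.coe_comp]
      exact (Submodule.mkQ_surjective _).comp φ.surjective_rangeRestrict)).length_eq.symm

/-- M/φ⁻¹(E) embeds in F/E, and g factors through it onto D. -/
theorem length_le_quotLength {E F : Submodule R Q} (φ : M →ₗ[R] Q) (hφ : ∀ x, φ x ∈ F)
    (g : M →ₗ[R] D) (hg : Function.Surjective g) (h : ∀ x, φ x ∈ E → g x = 0) :
    Module.length R D ≤ quotLength F E := by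
  let ψ : M →ₗ[R] F ⧸ E.submoduleOf F := (E.submoduleOf F).mkQ ∘ₗ φ.codRestrict F hφ
  have hψ : LinearMap.ker ψ ≤ LinearMap.ker g := by
    intro x hx
    rw [LinearMap.mem_ker, LinearMap.comp_apply, Submodule.mkQ_apply,
      Submodule.Quotient.mk_eq_zero] at hx
    exact h x hx
  calc Module.length R D ≤ Module.length R (M ⧸ LinearMap.ker ψ) :=
        Module.length_le_of_surjective ((LinearMap.ker ψ).liftQ g hψ) fun d => by
          obtain ⟨x, rfl⟩ := hg d
          exact ⟨Submodule.Quotient.mk x, rfl⟩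
    _ ≤ quotLength F E := Module.length_le_of_injective ((LinearMap.ker ψ).liftQ ψ le_rfl)
        (LinearMap.ker_eq_bot.mp (Submodule.ker_liftQ_eq_bot _ _ _ le_rfl))

/-- F/E is a quotient of F/ker g, which embeds in D. -/
theorem quotLength_le_length {E F : Submodule R Q} (g : F →ₗ[R] D)
    (h : ∀ x, g x = 0 → (x : Q) ∈ E) : quotLength F E ≤ Module.length R D :=
  calc quotLength F E ≤ Module.length R (F ⧸ LinearMap.ker g) :=
        Module.length_le_of_surjective
          ((LinearMap.ker g).liftQ (E.submoduleOf F).mkQ fun x hx => by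
            rw [Submodule.ker_mkQ]; exact h x hx) fun d => by
          obtain ⟨x, rfl⟩ := Submodule.Quotient.mk_surjective _ d
          exact ⟨Submodule.Quotient.mk x, rfl⟩
    _ ≤ Module.length R D := Module.length_le_of_injective ((LinearMap.ker g).liftQ g le_rfl)
        (LinearMap.ker_eq_bot.mp (Submodule.ker_liftQ_eq_bot _ _ _ le_rfl))

/-- The lengths of the steps of an increasing chain add up. -/
theorem sum_quotLength (F : ℕ → Submodule R Q) (hF : Monotone F) (m : ℕ) :
    ∑ j ∈ Finset.range m, quotLength (F (j + 1)) (F j) = quotLength (F m) (F 0) := by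
  induction m with
  | zero => simp [quotLength_self]
  | succ m ih =>
    rw [Finset.sum_range_succ, ih, ← quotLength_add (hF m.zero_le) (hF m.le_succ)]

/-- The lengths of the steps of a decreasing chain add up. -/
theorem sum_quotLength_of_antitone (F : ℕ → Submodule R Q) (hF : Antitone F) (m : ℕ) :
    ∑ j ∈ Finset.range m, quotLength (F j) (F (j + 1)) = quotLength (F 0) (F m) := by
  induction m with
  | zero => simp [quotLength_self]
  | succ m ih =>
    rw [Finset.sum_range_succ, ih, add_comm,
      ← quotLength_add (hF m.le_succ) (hF m.zero_le)]

theorem mem_idealInv {I : Ideal R} {x : Q} :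
    x ∈ idealInv R Q I ↔ ∀ y ∈ I, x * algebraMap R Q y ∈ (1 : Submodule R Q) := by
  rw [idealInv, Submodule.mem_div_iff_forall_mul_mem]
  constructor
  · intro h y hy
    exact h _ ((IsLocalization.mem_coeSubmodule Q I).mpr ⟨y, hy, rfl⟩)
  · intro h z hz
    obtain ⟨y, hy, rfl⟩ := (IsLocalization.mem_coeSubmodule Q I).mp hz
    exact h y hy

theorem idealInv_antitone : Antitone (idealInv R Q) := fun _ _ h _ hx =>
  mem_idealInv.mpr fun y hy => mem_idealInv.mp hx y (h hy)

theorem idealInv_top : idealInv R Q ⊤ = 1 := by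
  ext x
  rw [mem_idealInv]
  refine ⟨fun h => by simpa using h 1 trivial, fun hx y _ => ?_⟩
  rw [mul_comm, ← Algebra.smul_def]
  exact Submodule.smul_mem _ _ hx

end QuotLength

/-! ### Duality for a finite field extension -/

section ResidueField

/-- A linear functional on a finite field extension identifies the extension, by multiplication,
with its dual; hence the functionals on any subspace are obtained in this way. -/
theorem exists_mul_functional {k K M : Type*} [Field k] [Field K] [Algebra k K]
    [FiniteDimensional k K] [AddCommGroup M] [Module k M] (f : M →ₗ[k] K)
    (hf : Function.Injective f) (φ : Module.Dual k K) (hφ : φ ≠ 0) (ψ : Module.Dual k M) :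
    ∃ a : K, ∀ m, ψ m = φ (a * f m) := by
  -- If φ vanishes on aK with a ≠ 0, then φ = 0, because aK = K.
  have hinj : Function.Injective (LinearMap.compr₂ (LinearMap.mul k K) φ) := by
    rw [← LinearMap.ker_eq_bot, LinearMap.ker_eq_bot']
    intro a ha
    by_contra h0
    refine hφ (LinearMap.ext fun b => ?_)
    have := LinearMap.congr_fun ha (a⁻¹ * b)
    simpa [h0] using this
  have hsurj := (LinearMap.injective_iff_surjective_of_finrank_eq_finrank
    (Subspace.dual_finrank_eq (K := k) (V := K)).symm).mp hinj
  obtain ⟨ψ', rfl⟩ := LinearMap.dualMap_surjective_of_injective hf ψ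
  obtain ⟨a, rfl⟩ := hsurj ψ'
  exact ⟨a, fun m => rfl⟩

end ResidueField

/-! ### The value semigroup and the ideals 𝔞_i -/

section Fractions

variable (R : Type*) (Q : Type*) [CommRing R] [Field Q] [Algebra R Q] [AnalyticallyIrreducible R Q]

theorem valueAt_le_ordVal_iff {i : ℕ} {x : R} :
    x ∈ valueIdeal R Q i ↔ (valueAt R Q i : ℕ∞) ≤ ordVal R Q x := Iff.rfl

theorem natCast_le_addVal_iff {X : integralClosure R Q} (hX : Irreducible X) {n : ℕ}
    {x : integralClosure R Q} :
    (n : ℕ∞) ≤ IsDiscreteValuationRing.addVal (integralClosure R Q) x ↔ X ^ n ∣ x := by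
  rw [← IsDiscreteValuationRing.addVal_le_iff_dvd, IsDiscreteValuationRing.addVal_pow,
    IsDiscreteValuationRing.addVal_uniformizer hX, nsmul_one]

theorem mem_valueIdeal_iff {X : integralClosure R Q} (hX : Irreducible X) {i : ℕ} {x : R} :
    x ∈ valueIdeal R Q i ↔ X ^ valueAt R Q i ∣ algebraMap R (integralClosure R Q) x :=
  natCast_le_addVal_iff R Q hX

variable {R Q}

theorem valueSet_infinite {c : ℕ} (hc : ∀ n, c ≤ n → n ∈ valueSet R Q) :
    (Set.ofPred (· ∈ valueSet R Q)).Infinite :=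
  (Set.Ici_infinite c).mono fun n hn => hc n hn

theorem valueAt_strictMono {c : ℕ} (hc : ∀ n, c ≤ n → n ∈ valueSet R Q) :
    StrictMono (valueAt R Q) :=
  Nat.nth_strictMono (valueSet_infinite hc)

theorem valueAt_zero [IsDomain R] : valueAt R Q 0 = 0 := by
  refine Nat.nth_zero_of_zero (p := (· ∈ valueSet R Q)) ⟨1, one_ne_zero, ?_⟩
  simp [ordVal]

/-- There are no gaps from s_r on. This identifies N with s_{r+l}. -/
theorem valueAt_add {r : ℕ} (hr : ∀ n, valueAt R Q r ≤ n → n ∈ valueSet R Q) (l : ℕ) :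
    valueAt R Q (r + l) = valueAt R Q r + l := by
  induction l with
  | zero => rfl
  | succ l ih =>
    have hlt := valueAt_strictMono hr (Nat.lt_succ_self (r + l))
    refine le_antisymm ?_ (by rw [← add_assoc, ← add_assoc, ← ih]; exact hlt)
    by_contra! hcon
    have := Nat.le_nth_of_lt_nth_succ (p := (· ∈ valueSet R Q)) hcon (hr _ (by omega))
    change _ ≤ valueAt R Q (r + l) at this
    omega

theorem valueIdeal_antitone {c : ℕ} (hc : ∀ n, c ≤ n → n ∈ valueSet R Q) :
    Antitone (valueIdeal R Q) := fun _ _ h _ hx =>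
  (valueAt_le_ordVal_iff R Q).mpr ((Nat.cast_le.mpr ((valueAt_strictMono hc).monotone h)).trans
    ((valueAt_le_ordVal_iff R Q).mp hx))

theorem valueIdeal_zero [IsDomain R] : valueIdeal R Q 0 = ⊤ := by
  ext x
  simp [valueAt_le_ordVal_iff, valueAt_zero]

theorem valueIdeal_one [IsDomain R] [IsFractionRing R Q] [IsLocalRing R] {c : ℕ} (hc : ∀ n, c ≤ n → n ∈ valueSet R Q) :
    valueIdeal R Q 1 = maximalIdeal R := by
  apply le_antisymm
  · refine le_maximalIdeal fun h => ?_
    have h1 : (1 : R) ∈ valueIdeal R Q 1 := h ▸ trivial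
    have hlt := valueAt_strictMono hc Nat.zero_lt_one
    rw [valueAt_le_ordVal_iff] at h1
    simp [ordVal] at h1
    omega
  · intro x hx
    simpa using mul_mem_valueIdeal_succ R Q hx
      (show (1 : R) ∈ valueIdeal R Q 0 from valueIdeal_zero (R := R) (Q := Q) ▸ trivial)

end Fractions

/-! ### The conductor, and the two chains from R to C and from R to R̄ -/

section ValueFiltration

variable (R : Type*) (Q : Type*) [CommRing R] [Field Q] [Algebra R Q]

section Conductor

variable {R Q} {X : integralClosure R Q} {N : ℕ}

theorem mem_conductorModule_iff
    (hN : conductorModule R Q = ((X : Q) ^ N) • intClosure R Q) {z : Q} :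
    z ∈ conductorModule R Q ↔ ∃ w : integralClosure R Q, z = (X ^ N * w : integralClosure R Q) := by
  rw [hN, Submodule.mem_smul_pointwise_iff_exists]
  constructor
  · rintro ⟨w, hw, rfl⟩
    exact ⟨⟨w, hw⟩, by simp⟩
  · rintro ⟨w, rfl⟩
    exact ⟨w, w.2, by simp⟩

theorem conductorModule_le_one : conductorModule R Q ≤ 1 := fun x hx => by
  have := Submodule.mem_div_iff_forall_mul_mem.mp hx 1 (one_mem (integralClosure R Q))
  rwa [mul_one] at this

theorem coe_pow_mul_mem_one (hN : conductorModule R Q = ((X : Q) ^ N) • intClosure R Q)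
    {z : integralClosure R Q} (hz : X ^ N ∣ z) : (z : Q) ∈ (1 : Submodule R Q) := by
  obtain ⟨w, rfl⟩ := hz
  exact conductorModule_le_one ((mem_conductorModule_iff hN).mpr ⟨w, rfl⟩)

variable [AnalyticallyIrreducible R Q]

/-- Since C ⊆ R, every element of X^N R̄ already lies in R. -/
theorem coeSubmodule_valueIdeal_eq_conductorModule (hX : Irreducible X)
    (hN : conductorModule R Q = ((X : Q) ^ N) • intClosure R Q) {m : ℕ}
    (hm : valueAt R Q m = N) :
    IsLocalization.coeSubmodule Q (valueIdeal R Q m) = conductorModule R Q := by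
  ext z
  rw [IsLocalization.mem_coeSubmodule, mem_conductorModule_iff hN]
  constructor
  · rintro ⟨x, hx, rfl⟩
    rw [mem_valueIdeal_iff R Q hX, hm] at hx
    obtain ⟨w, hw⟩ := hx
    exact ⟨w, congrArg Subtype.val hw⟩
  · rintro ⟨w, hw⟩
    obtain ⟨x, rfl⟩ := Submodule.mem_one.mp
      (hw ▸ coe_pow_mul_mem_one hN (Dvd.intro w rfl) : z ∈ (1 : Submodule R Q))
    refine ⟨x, ?_, rfl⟩
    rw [mem_valueIdeal_iff R Q hX, hm]
    exact ⟨w, Subtype.ext hw⟩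

/-- C is an R̄-module, so zC ⊆ R forces z X^N ∈ R : R̄ = X^N R̄, and X^N cancels. -/
theorem idealInv_valueIdeal_eq_intClosure (hX : Irreducible X)
    (hN : conductorModule R Q = ((X : Q) ^ N) • intClosure R Q) {m : ℕ}
    (hm : valueAt R Q m = N) : idealInv R Q (valueIdeal R Q m) = intClosure R Q := by
  have hX0 : (X : Q) ^ N ≠ 0 := pow_ne_zero _ fun h => hX.ne_zero (Subtype.ext h)
  rw [idealInv, coeSubmodule_valueIdeal_eq_conductorModule hX hN hm]
  ext z
  rw [Submodule.mem_div_iff_forall_mul_mem]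
  constructor
  · intro h
    have hz : (X : Q) ^ N * z ∈ conductorModule R Q := by
      refine Submodule.mem_div_iff_forall_mul_mem.mpr fun w hw => ?_
      convert h _ ((mem_conductorModule_iff hN).mpr ⟨⟨w, hw⟩, rfl⟩) using 1
      simp only [MulMemClass.coe_mul, SubmonoidClass.coe_pow]
      ring
    obtain ⟨w, hw⟩ := (mem_conductorModule_iff hN).mp hz
    have : z = w := mul_left_cancel₀ hX0 (by simpa using hw)
    exact this ▸ w.2
  · intro hz y hy
    obtain ⟨w, rfl⟩ := (mem_conductorModule_iff hN).mp hy
    have hmem := coe_pow_mul_mem_one hN (Dvd.intro (w * ⟨z, hz⟩) rfl)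
    convert hmem using 1
    simp only [MulMemClass.coe_mul]
    ring

end Conductor

variable [AnalyticallyIrreducible R Q]

theorem quotLength_intClosure_one [IsDomain R] {X : integralClosure R Q} (hX : Irreducible X) {N : ℕ}
    (hN : conductorModule R Q = ((X : Q) ^ N) • intClosure R Q) {c : ℕ}
    (hc : ∀ n, c ≤ n → n ∈ valueSet R Q) {m : ℕ} (hm : valueAt R Q m = N) :
    quotLength (intClosure R Q) 1 = ∑ j, typeSequence R Q m j := by
  have h := sum_quotLength (fun i => idealInv R Q (valueIdeal R Q i))
    (fun i j hij => idealInv_antitone (valueIdeal_antitone hc hij)) m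
  rw [Finset.sum_range] at h
  rw [← idealInv_valueIdeal_eq_intClosure hX hN hm, ← idealInv_top, ← valueIdeal_zero (Q := Q)]
  exact h.symm

variable [IsFractionRing R Q]

theorem quotLength_coeSubmodule_valueIdeal (i : ℕ) :
    quotLength (IsLocalization.coeSubmodule Q (valueIdeal R Q i))
      (IsLocalization.coeSubmodule Q (valueIdeal R Q (i + 1))) =
      Module.length R (valueQuot R Q i) := by
  have hrange : IsLocalization.coeSubmodule Q (valueIdeal R Q i) =
      LinearMap.range (Algebra.linearMap R Q ∘ₗ (valueIdeal R Q i).subtype) := by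
    rw [LinearMap.range_comp, Submodule.range_subtype]
    rfl
  have hcomap : (IsLocalization.coeSubmodule Q (valueIdeal R Q (i + 1))).comap
      (Algebra.linearMap R Q ∘ₗ (valueIdeal R Q i).subtype) =
      (valueIdeal R Q (i + 1)).submoduleOf (valueIdeal R Q i) := by
    rw [Submodule.comap_comp]
    exact congrArg _ (Submodule.comap_map_eq_of_injective (IsFractionRing.injective R Q) _)
  rw [hrange, quotLength_eq_length_quotient, hcomap]

variable [IsDomain R]

variable [IsLocalRing R]

instance (i : ℕ) : IsScalarTower R (ResidueField R) (valueQuot R Q i) :=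
  (valueQuot_isTorsionBySet R Q i).isScalarTower

/-- The quotient 𝔞_0/𝔞_1 is k itself; this term accounts for the 1 in the definition of almost
Gorenstein. -/
theorem valueDim_zero {c : ℕ} (hc : ∀ n, c ≤ n → n ∈ valueSet R Q) : valueDim R Q 0 = 1 := by
  have htop : (1 : R) ∈ valueIdeal R Q 0 := by rw [valueIdeal_zero]; trivial
  refine finrank_eq_one (Submodule.Quotient.mk ⟨1, htop⟩) ?_ fun w => ?_
  · rw [Ne, Submodule.Quotient.mk_eq_zero]
    change (1 : R) ∉ valueIdeal R Q 1
    rw [valueIdeal_one hc]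
    exact (Ideal.ne_top_iff_one _).mp (maximalIdeal.isMaximal R).ne_top
  · obtain ⟨x, rfl⟩ := Submodule.Quotient.mk_surjective _ w
    refine ⟨residue R x, ?_⟩
    change algebraMap R (ResidueField R) x • _ = _
    rw [algebraMap_smul, ← Submodule.Quotient.mk_smul]
    congr 1
    ext
    simp

variable [IsNoetherianRing R]

instance (i : ℕ) : Module.Finite (ResidueField R) (valueQuot R Q i) :=
  .of_restrictScalars_finite R _ _

theorem length_valueQuot (i : ℕ) :
    Module.length R (valueQuot R Q i) = valueDim R Q i := by
  rw [Module.length_eq_of_surjective (R := ResidueField R) residue_surjective,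
    Module.length_eq_finrank, valueDim]

/-- The lengths of the steps of the value filtration add up to the length of `R` modulo its
conductor. -/
theorem quotLength_one_conductorModule {X : integralClosure R Q} (hX : Irreducible X) {N : ℕ}
    (hN : conductorModule R Q = ((X : Q) ^ N) • intClosure R Q) {c : ℕ}
    (hc : ∀ n, c ≤ n → n ∈ valueSet R Q) {m : ℕ} (hm : valueAt R Q m = N) :
    quotLength 1 (conductorModule R Q) = ∑ j ∈ Finset.range m, (valueDim R Q j : ℕ∞) := by
  have h := sum_quotLength_of_antitone
    (fun i => IsLocalization.coeSubmodule Q (valueIdeal R Q i))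
    (fun i j hij => IsLocalization.coeSubmodule_mono Q (valueIdeal_antitone hc hij)) m
  simp only [quotLength_coeSubmodule_valueIdeal, length_valueQuot] at h
  rw [h, coeSubmodule_valueIdeal_eq_conductorModule hX hN hm, valueIdeal_zero,
    IsLocalization.coeSubmodule_top]

end ValueFiltration

/-! ### The bounds n_i ≤ t_{i+1} ≤ t(R) n_i -/

section TypeBounds

variable {R : Type*} {Q : Type*} [CommRing R] [IsDomain R] [Field Q] [Algebra R Q]
  [IsFractionRing R Q] [AnalyticallyIrreducible R Q] [IsLocalRing R]

/-- Some nonzero functional on the residue field of the integral closure vanishes on the leading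
coefficients of the elements of `R` of value at least `N - 1`. -/
theorem exists_functional_leadingCoeff {X : integralClosure R Q} (hX : Irreducible X) {N : ℕ}
    (hN : conductorModule R Q = ((X : Q) ^ (N + 1)) • intClosure R Q) :
    ∃ φ : Module.Dual (ResidueField R) (ResidueField (integralClosure R Q)), φ ≠ 0 ∧
      ∀ z : integralClosure R Q, ((X ^ N * z : integralClosure R Q) : Q) ∈ (1 : Submodule R Q) →
        φ (residue _ z) = 0 := by
  -- The conductor exponent is N + 1 here, so W consists of the coefficients at the last exponent
  -- before the conductor.
  let W : Submodule (ResidueField R) (ResidueField (integralClosure R Q)) :=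
    { carrier := {w | ∃ z : integralClosure R Q,
        ((X ^ N * z : integralClosure R Q) : Q) ∈ (1 : Submodule R Q) ∧ residue _ z = w}
      zero_mem' := ⟨0, by simp, map_zero _⟩
      add_mem' := by
        rintro _ _ ⟨z, hz, rfl⟩ ⟨z', hz', rfl⟩
        refine ⟨z + z', ?_, map_add _ _ _⟩
        rw [mul_add]
        exact add_mem hz hz'
      smul_mem' := by
        rintro a _ ⟨z, hz, rfl⟩
        obtain ⟨a, rfl⟩ := residue_surjective a
        refine ⟨a • z, ?_, ?_⟩
        · rw [mul_smul_comm]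
          exact Submodule.smul_mem _ a hz
        · rw [Algebra.smul_def, Algebra.smul_def, map_mul]
          rfl }
  -- If W were everything, each X^N b could be corrected by an element of X^(N+1) R̄ = C to lie in
  -- R, whence X^N ∈ C, which is absurd.
  have hW : W < ⊤ := by
    rw [lt_top_iff_ne_top]
    intro htop
    have hmem : ∀ b : integralClosure R Q,
        ((X ^ N * b : integralClosure R Q) : Q) ∈ (1 : Submodule R Q) := by
      intro b
      obtain ⟨z, hz, hzb⟩ : residue _ b ∈ W := htop ▸ trivial
      have hdvd : X ∣ b - z := by
        rw [← Ideal.mem_span_singleton, ← hX.maximalIdeal_eq, ← residue_eq_zero_iff, map_sub, hzb,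
          sub_self]
      have h1 := coe_pow_mul_mem_one hN (pow_succ X N ▸ mul_dvd_mul_left (X ^ N) hdvd)
      rw [mul_sub] at h1
      exact (Submodule.sub_mem_iff_left _ hz).mp h1
    have hC : ((X ^ N : integralClosure R Q) : Q) ∈ conductorModule R Q :=
      Submodule.mem_div_iff_forall_mul_mem.mpr fun w hw => hmem ⟨w, hw⟩
    obtain ⟨w, hw⟩ := (mem_conductorModule_iff hN).mp hC
    have h2 : X ^ N * (X * w) = X ^ N * 1 := by
      rw [← mul_assoc, ← pow_succ, mul_one]
      exact (Subtype.ext hw).symm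
    exact hX.not_isUnit (IsUnit.of_mul_eq_one w (mul_left_cancel₀ (pow_ne_zero _ hX.ne_zero) h2))
  obtain ⟨φ, hφ, hle⟩ := W.exists_le_ker_of_lt_top hW
  exact ⟨φ, hφ, fun z hz => hle ⟨z, hz, rfl⟩⟩

/-- Taking leading coefficients embeds `𝔞_i / 𝔞_{i+1}` into the residue field of the integral
closure. -/
theorem exists_leadingCoeff {X : integralClosure R Q} (hX : Irreducible X) {c : ℕ}
    (hc : ∀ n, c ≤ n → n ∈ valueSet R Q) (i : ℕ) :
    ∃ f : valueQuot R Q i →ₗ[ResidueField R] ResidueField (integralClosure R Q),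
      Function.Injective f ∧ ∀ (y : valueIdeal R Q i) (d : integralClosure R Q),
        algebraMap R (integralClosure R Q) y = X ^ valueAt R Q i * d →
          f (Submodule.Quotient.mk y) = residue _ d := by
  have hX0 : X ^ valueAt R Q i ≠ 0 := pow_ne_zero _ hX.ne_zero
  choose d hd using fun y : valueIdeal R Q i => (mem_valueIdeal_iff R Q hX).mp y.2
  let δ : valueIdeal R Q i →ₗ[R] integralClosure R Q :=
    { toFun := d
      map_add' := fun y z => mul_left_cancel₀ hX0 (by rw [mul_add, ← hd, ← hd, ← hd]; simp)
      map_smul' := fun a y => mul_left_cancel₀ hX0 (by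
        rw [RingHom.id_apply, mul_smul_comm, ← hd, ← hd, Algebra.smul_def]; simp) }
  let ρ : integralClosure R Q →ₗ[R] ResidueField (integralClosure R Q) :=
    (IsScalarTower.toAlgHom R (integralClosure R Q) _).toLinearMap
  have hker : LinearMap.ker (ρ ∘ₗ δ) =
      (valueIdeal R Q (i + 1)).submoduleOf (valueIdeal R Q i) := by
    ext y
    have hlt := valueAt_strictMono hc (Nat.lt_succ_self i)
    have h1 : y ∈ LinearMap.ker (ρ ∘ₗ δ) ↔ X ∣ d y := by
      rw [← Ideal.mem_span_singleton, ← hX.maximalIdeal_eq, ← residue_eq_zero_iff]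
      rfl
    have h2 : X ∣ d y ↔ X ^ (valueAt R Q i + 1) ∣ algebraMap R (integralClosure R Q) y := by
      rw [hd, pow_succ, mul_dvd_mul_iff_left hX0]
    rw [h1, h2]
    change _ ↔ (y : R) ∈ valueIdeal R Q (i + 1)
    rw [mem_valueIdeal_iff R Q hX]
    -- No value of R lies strictly between s_i and s_{i+1}, so a value above s_i is at least
    -- s_{i+1}.
    refine ⟨fun h => ?_, (pow_dvd_pow X hlt).trans⟩
    rw [← natCast_le_addVal_iff R Q hX] at h
    rw [← mem_valueIdeal_iff R Q hX, valueAt_le_ordVal_iff]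
    change _ ≤ ordVal R Q y at h
    cases hv : ordVal R Q y with
    | top => exact le_top
    | coe n =>
      rw [hv, Nat.cast_le] at h
      have hn : n ∈ valueSet R Q := ⟨y, fun h0 => by simp [h0, ordVal] at hv, hv⟩
      rw [Nat.cast_le]
      by_contra! hcon
      exact absurd (Nat.le_nth_of_lt_nth_succ hcon hn) (not_le.mpr h)
  let f : valueQuot R Q i →ₗ[R] ResidueField (integralClosure R Q) :=
    Submodule.liftQ _ (ρ ∘ₗ δ) hker.ge
  have hf : Function.Injective f :=
    LinearMap.ker_eq_bot.mp (Submodule.ker_liftQ_eq_bot _ (ρ ∘ₗ δ) hker.ge hker.le)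
  refine ⟨f.extendScalarsOfSurjective residue_surjective, hf, fun y e he => ?_⟩
  · have : d y = e := mul_left_cancel₀ hX0 ((hd y).symm.trans he)
    rw [← this]
    rfl

variable [IsNoetherianRing R]

/-- For y ∈ 𝔞_i, 𝔪y ⊆ 𝔞_{i+1}, so multiplication by y carries 𝔞_{i+1}⁻¹ into 𝔪⁻¹. An element sent
into R by lifts of a basis of 𝔞_i/𝔞_{i+1} is in 𝔞_i⁻¹. -/
theorem quotLength_idealInv_le (i : ℕ) :
    quotLength (idealInv R Q (valueIdeal R Q (i + 1))) (idealInv R Q (valueIdeal R Q i)) ≤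
      cmType R Q * valueDim R Q i := by
  let b : Module.Basis (Fin (valueDim R Q i)) (ResidueField R) (valueQuot R Q i) :=
    Module.finBasis (ResidueField R) (valueQuot R Q i)
  choose y hy using fun j => Submodule.Quotient.mk_surjective _ (b j)
  have hspan : ∀ z ∈ valueIdeal R Q i, ∃ a : Fin (valueDim R Q i) → R,
      z - ∑ j, a j * y j ∈ valueIdeal R Q (i + 1) := by
    intro z hz
    choose a ha using fun j => residue_surjective (b.repr (Submodule.Quotient.mk ⟨z, hz⟩) j)
    refine ⟨a, ?_⟩
    have h : (Submodule.Quotient.mk ⟨z, hz⟩ : valueQuot R Q i) =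
        Submodule.Quotient.mk (∑ j, a j • y j) := by
      rw [← Submodule.mkQ_apply _ (∑ j, a j • y j), map_sum]
      refine (b.sum_repr _).symm.trans (Finset.sum_congr rfl fun j _ => ?_)
      rw [map_smul, Submodule.mkQ_apply, hy, ← ha]
      exact algebraMap_smul _ _ _
    rw [Submodule.Quotient.eq] at h
    have h' : ((⟨z, hz⟩ - ∑ j, a j • y j : valueIdeal R Q i) : R) ∈ valueIdeal R Q (i + 1) := h
    simpa using h'
  have hmem : ∀ j, ∀ x ∈ idealInv R Q (valueIdeal R Q (i + 1)),
      LinearMap.mulRight R (algebraMap R Q (y j)) x ∈ idealInv R Q (maximalIdeal R) := by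
    intro j x hx
    rw [mem_idealInv] at hx ⊢
    intro p hp
    have := hx _ (mul_mem_valueIdeal_succ R Q hp (y j).2)
    rw [map_mul] at this
    rw [LinearMap.mulRight_apply]
    convert this using 1
    ring
  let g : idealInv R Q (valueIdeal R Q (i + 1)) →ₗ[R] Fin (valueDim R Q i) →
      (idealInv R Q (maximalIdeal R) ⧸ (1 : Submodule R Q).submoduleOf
        (idealInv R Q (maximalIdeal R))) :=
    LinearMap.pi fun j => Submodule.mkQ _ ∘ₗ
      (LinearMap.mulRight R (algebraMap R Q (y j))).restrict (hmem j)
  calc _ ≤ Module.length R (Fin (valueDim R Q i) → _) := quotLength_le_length g ?_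
    _ = cmType R Q * valueDim R Q i := by
      rw [Module.length_pi, mul_comm]
      simp [cmType, quotLength]
  intro x hx
  rw [mem_idealInv]
  intro z hz
  obtain ⟨a, ha⟩ := hspan z hz
  have hxy : ∀ j, (x : Q) * algebraMap R Q (y j) ∈ (1 : Submodule R Q) := by
    intro j
    have h : Submodule.Quotient.mk ((LinearMap.mulRight R (algebraMap R Q (y j))).restrict
      (hmem j) x) = 0 := congrFun hx j
    rw [Submodule.Quotient.mk_eq_zero] at h
    exact h
  rw [← sub_add_cancel z (∑ j, a j * y j), map_add, mul_add, map_sum, Finset.mul_sum]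
  refine add_mem (mem_idealInv.mp x.2 _ ha) (Submodule.sum_mem _ fun j _ => ?_)
  rw [map_mul, mul_left_comm, ← Algebra.smul_def]
  exact Submodule.smul_mem _ _ (hxy j)

theorem valueDim_le_quotLength {X : integralClosure R Q} (hX : Irreducible X) {N : ℕ}
    (hN : conductorModule R Q = ((X : Q) ^ N) • intClosure R Q) {c : ℕ}
    (hc : ∀ n, c ≤ n → n ∈ valueSet R Q) {i : ℕ} (hi : valueAt R Q i < N) :
    (valueDim R Q i : ℕ∞) ≤
      quotLength (idealInv R Q (valueIdeal R Q (i + 1))) (idealInv R Q (valueIdeal R Q i)) := by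
  -- Thus e = N - 1 - s_i: X^e 𝔞_{i+1} falls into C, while X^e 𝔞_i has values at least N - 1, where
  -- φ applies.
  obtain ⟨e, rfl⟩ := Nat.exists_eq_add_of_lt hi
  obtain ⟨φ, hφ, hφ0⟩ := exists_functional_leadingCoeff hX hN
  obtain ⟨f, hf, hfres⟩ := exists_leadingCoeff hX hc i
  let ρ : integralClosure R Q →ₗ[R] ResidueField (integralClosure R Q) :=
    (IsScalarTower.toAlgHom R (integralClosure R Q) _).toLinearMap
  let T : ResidueField (integralClosure R Q) →ₗ[ResidueField R]
      Module.Dual (ResidueField R) (valueQuot R Q i) :=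
    f.dualMap ∘ₗ LinearMap.compr₂ (LinearMap.mul _ _) φ
  let h : integralClosure R Q →ₗ[R] Q :=
    (integralClosure R Q).val.toLinearMap ∘ₗ LinearMap.mulLeft R (X ^ e)
  have hlen : Module.length R (Module.Dual (ResidueField R) (valueQuot R Q i)) =
      valueDim R Q i := by
    rw [Module.length_eq_of_surjective (R := ResidueField R) residue_surjective,
      Module.length_eq_finrank, Subspace.dual_finrank_eq, valueDim]
  rw [← hlen]
  refine length_le_quotLength h (fun b => ?_) (T.restrictScalars R ∘ₗ ρ) ?_ fun b hb => ?_
  · rw [mem_idealInv]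
    intro y hy
    have hlt := valueAt_strictMono hc (Nat.lt_succ_self i)
    rw [mem_valueIdeal_iff R Q hX] at hy
    refine coe_pow_mul_mem_one (z := X ^ e * b * algebraMap R _ y) hN ?_
    have := mul_dvd_mul (dvd_mul_right (X ^ e) b) ((pow_dvd_pow X hlt).trans hy)
    rw [← pow_add] at this
    convert this using 2
    omega
  · intro ψ
    obtain ⟨a, ha⟩ := exists_mul_functional f hf φ hφ ψ
    obtain ⟨b, rfl⟩ := residue_surjective a
    exact ⟨b, LinearMap.ext fun m => (ha m).symm⟩
  · refine LinearMap.ext fun m => ?_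
    obtain ⟨y, rfl⟩ := Submodule.Quotient.mk_surjective _ m
    obtain ⟨d, hd⟩ := (mem_valueIdeal_iff R Q hX).mp y.2
    change φ (residue _ b * f (Submodule.Quotient.mk y)) = 0
    rw [hfres y d hd, ← map_mul]
    apply hφ0
    have h1 : ((X ^ e * b * algebraMap R _ (y : R) : integralClosure R Q) : Q) ∈
        (1 : Submodule R Q) := mem_idealInv.mp hb y y.2
    rw [hd] at h1
    convert h1 using 2
    ring

end TypeBounds

/-! ### Finiteness of the type, and comparison of sums -/

section TypeSequence

variable {R : Type*} {Q : Type*} [CommRing R] [Field Q] [Algebra R Q]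
  [AnalyticallyIrreducible R Q] [IsLocalRing R]

/-- Inside the finite module R̄, 𝔪⁻¹ is finitely generated, so 𝔪⁻¹/R is a finite-dimensional
k-space. -/
theorem cmType_ne_top [IsNoetherianRing R]
    (h : idealInv R Q (maximalIdeal R) ≤ intClosure R Q) : cmType R Q ≠ ⊤ := by
  have : IsNoetherian R (intClosure R Q) :=
    inferInstanceAs (IsNoetherian R (integralClosure R Q))
  have : IsNoetherian R (idealInv R Q (maximalIdeal R)) := isNoetherian_of_le h
  have htors : Module.IsTorsionBySet R (idealInv R Q (maximalIdeal R) ⧸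
      (1 : Submodule R Q).submoduleOf (idealInv R Q (maximalIdeal R))) (maximalIdeal R) := by
    rintro z ⟨p, hp⟩
    obtain ⟨x, rfl⟩ := Submodule.Quotient.mk_surjective _ z
    change Submodule.Quotient.mk (p • x) = 0
    rw [Submodule.Quotient.mk_eq_zero]
    change p • (x : Q) ∈ (1 : Submodule R Q)
    rw [Algebra.smul_def, mul_comm]
    exact mem_idealInv.mp x.2 p hp
  let _ : Module (ResidueField R) _ := htors.module
  have : IsScalarTower R (ResidueField R) _ := htors.isScalarTower
  have : Module.Finite (ResidueField R) (idealInv R Q (maximalIdeal R) ⧸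
      (1 : Submodule R Q).submoduleOf (idealInv R Q (maximalIdeal R))) :=
    .of_restrictScalars_finite R _ _
  rw [cmType, quotLength, Module.length_eq_of_surjective (R := ResidueField R) residue_surjective,
    Module.length_eq_finrank]
  exact ENat.natCast_ne_top _

/-- Here 𝔪 = xR, so 𝔪⁻¹ = x⁻¹R and 𝔪⁻¹/R ≅ R/𝔪. It settles the case r + l = 0. -/
theorem cmType_eq_one_of_intClosure_eq_one [IsDomain R] [IsFractionRing R Q]
    (h : intClosure R Q = 1) : cmType R Q = 1 := by
  obtain ⟨X, hX⟩ := IsDiscreteValuationRing.exists_irreducible (integralClosure R Q)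
  have hV : ∀ z : integralClosure R Q, ∃ r : R, algebraMap R (integralClosure R Q) r = z := by
    intro z
    obtain ⟨r, hr⟩ := Submodule.mem_one.mp (h ▸ z.2 : (z : Q) ∈ (1 : Submodule R Q))
    exact ⟨r, Subtype.ext hr⟩
  obtain ⟨x, rfl⟩ := hV X
  have hx0 : algebraMap R Q x ≠ 0 := fun h0 => hX.ne_zero (Subtype.ext h0)
  have hmem : ∀ y, y ∈ maximalIdeal R ↔ x ∣ y := by
    intro y
    rw [mem_maximalIdeal, mem_nonunits_iff, ← isUnit_map_iff (algebraMap R (integralClosure R Q)),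
      ← mem_nonunits_iff, ← mem_maximalIdeal, hX.maximalIdeal_eq, Ideal.mem_span_singleton]
    refine ⟨fun ⟨w, hw⟩ => ?_, map_dvd _⟩
    obtain ⟨w, rfl⟩ := hV w
    exact ⟨w, FaithfulSMul.algebraMap_injective R (integralClosure R Q) (by rw [hw, map_mul])⟩
  let φ : R →ₗ[R] Q := LinearMap.mulRight R (algebraMap R Q x)⁻¹ ∘ₗ Algebra.linearMap R Q
  have hφ : ∀ r, φ r = algebraMap R Q r * (algebraMap R Q x)⁻¹ := fun _ => rfl
  have hrange : LinearMap.range φ = idealInv R Q (maximalIdeal R) := by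
    ext z
    rw [mem_idealInv]
    constructor
    · rintro ⟨r, rfl⟩ y hy
      obtain ⟨w, rfl⟩ := (hmem y).mp hy
      refine Submodule.mem_one.mpr ⟨r * w, ?_⟩
      rw [hφ, map_mul, map_mul]
      field_simp
    · intro hz
      obtain ⟨r, hr⟩ := Submodule.mem_one.mp (hz x ((hmem x).mpr dvd_rfl))
      exact ⟨r, by rw [hφ, hr, mul_inv_cancel_right₀ hx0]⟩
  have hcomap : (1 : Submodule R Q).comap φ = maximalIdeal R := by
    ext r
    rw [Submodule.mem_comap, Submodule.mem_one, hmem, hφ]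
    constructor
    · rintro ⟨s, hs⟩
      refine ⟨s, IsFractionRing.injective R Q ?_⟩
      rw [map_mul, hs]
      field_simp
    · rintro ⟨s, rfl⟩
      refine ⟨s, ?_⟩
      rw [map_mul]
      field_simp
  rw [cmType, ← hrange, quotLength_eq_length_quotient, hcomap, Module.length_eq_one_iff,
    isSimpleModule_iff_isCoatom]
  exact Ideal.isMaximal_def.mp (maximalIdeal.isMaximal R)

/-- Two finite families with the same term at `0`, one below the other and with finite values, agree
if and only if their sums agree. -/
theorem eq_ite_iff_sum_eq {k : ℕ} {t u : Fin (k + 1) → ℕ∞} {a : ℕ∞} (h0 : t 0 = a)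
    (hle : (∀ j : Fin k, t j.succ ≤ u j.succ) ∨ ∀ j : Fin k, u j.succ ≤ t j.succ)
    (ha : a ≠ ⊤) (ht : ∀ j, t j ≠ ⊤) (hu : ∀ j, u j ≠ ⊤) :
    t = (fun j : Fin (k + 1) => if (j : ℕ) = 0 then a else u j) ↔
      ∑ j, t j = a + ∑ j : Fin k, u j.succ := by
  have hpt : t = (fun j : Fin (k + 1) => if (j : ℕ) = 0 then a else u j) ↔
      ∀ j : Fin k, t j.succ = u j.succ := by
    rw [funext_iff, Fin.forall_fin_succ]
    simp [h0]
  rw [hpt, Fin.sum_univ_succ, h0]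
  refine Iff.trans ?_ (ENat.add_right_injective_of_ne_top ha).eq_iff.symm
  -- Finiteness is essential: in `ℕ∞` an infinite term would hide strict inequalities elsewhere.
  lift t to Fin (k + 1) → ℕ using ht
  lift u to Fin (k + 1) → ℕ using hu
  simp only [Nat.cast_le, Nat.cast_inj] at hle ⊢
  rw [← Nat.cast_sum, ← Nat.cast_sum, Nat.cast_inj]
  rcases hle with hle | hle
  · rw [Finset.sum_eq_sum_iff_of_le fun j _ => hle j]
    simp
  · rw [eq_comm, Finset.sum_eq_sum_iff_of_le fun j _ => hle j]
    simp [eq_comm]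

end TypeSequence

theorem mainTheorem1 (R Q : Type*) [CommRing R] [IsDomain R]
    [IsLocalRing R] [IsNoetherianRing R] (hdim : ringKrullDim R = 1)
    [Field Q] [Algebra R Q] [IsFractionRing R Q] [AnalyticallyIrreducible R Q]
    -- `X` generates the maximal ideal of the integral closure, and `C = X ^ N` times it
    (X : integralClosure R Q) (hX : Irreducible X) (N : ℕ)
    (hN : conductorModule R Q = ((X : Q) ^ N) • intClosure R Q)
    -- `s_r` is the least `c` with `c, c + 1, … ∈ v(R)`, and `N = s_r + l`
    (r l : ℕ) (hr : IsLeast {c : ℕ | ∀ n, c ≤ n → n ∈ valueSet R Q} (valueAt R Q r))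
    (hl : N = valueAt R Q r + l) :
    (IsAlmostGorenstein R Q ↔
      typeSequence R Q (r + l) =
        fun j : Fin (r + l) => if (j : ℕ) = 0 then cmType R Q else (valueDim R Q j : ℕ∞)) ∧
    (IsOfMaximalLength R Q ↔
      typeSequence R Q (r + l) =
        fun j : Fin (r + l) => if (j : ℕ) = 0 then cmType R Q else cmType R Q * (valueDim R Q j : ℕ∞)) := by
  have hc : ∀ n, valueAt R Q r ≤ n → n ∈ valueSet R Q := hr.1
  have hm : valueAt R Q (r + l) = N := (valueAt_add hc l).trans hl.symm
  rw [IsAlmostGorenstein, IsOfMaximalLength, quotLength_one_conductorModule R Q hX hN hc hm,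
    quotLength_intClosure_one R Q hX hN hc hm]
  have hinv := idealInv_valueIdeal_eq_intClosure hX hN hm
  have hmono : StrictMono (valueAt R Q) := valueAt_strictMono hc
  generalize r + l = m at *
  cases m with
  | zero =>
    rw [valueIdeal_zero, idealInv_top] at hinv
    have h1 := cmType_eq_one_of_intClosure_eq_one hinv.symm
    exact ⟨iff_of_true (by simp [h1]) (Subsingleton.elim _ _),
      iff_of_true (by simp) (Subsingleton.elim _ _)⟩
  | succ k =>
    have ht : cmType R Q ≠ ⊤ := by
      refine cmType_ne_top ?_
      rw [← hinv, ← valueIdeal_one (Q := Q) hc]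
      exact idealInv_antitone (valueIdeal_antitone hc (by omega))
    have h0 : typeSequence R Q (k + 1) 0 = cmType R Q := by
      change quotLength (idealInv R Q (valueIdeal R Q 1)) (idealInv R Q (valueIdeal R Q 0)) = _
      rw [valueIdeal_zero, idealInv_top, valueIdeal_one hc, cmType]
    have hle : ∀ j : Fin (k + 1), typeSequence R Q (k + 1) j ≤ cmType R Q * valueDim R Q j :=
      fun j => quotLength_idealInv_le j
    have hge : ∀ j : Fin (k + 1), (valueDim R Q j : ℕ∞) ≤ typeSequence R Q (k + 1) j :=
      fun j => valueDim_le_quotLength hX hN hc (hm ▸ hmono j.2)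
    have hfin : ∀ j : Fin (k + 1), cmType R Q * (valueDim R Q j : ℕ∞) ≠ ⊤ :=
      fun j => WithTop.mul_ne_top ht (ENat.natCast_ne_top _)
    have htop : ∀ j, typeSequence R Q (k + 1) j ≠ ⊤ :=
      fun j => ne_top_of_le_ne_top (hfin j) (hle j)
    rw [eq_ite_iff_sum_eq h0 (Or.inr fun j => hge j.succ) ht htop fun _ => ENat.natCast_ne_top _,
      eq_ite_iff_sum_eq h0 (Or.inl fun j => hle j.succ) ht htop hfin,
      Finset.sum_range, Fin.sum_univ_succ (fun j : Fin (k + 1) => (valueDim R Q j : ℕ∞)),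
      Fin.val_zero, valueDim_zero R Q hc, mul_add, Finset.mul_sum, Nat.cast_one, mul_one]
    refine ⟨?_, Iff.rfl⟩
    -- The 1 on the right is n_0; it cancels against the 1 added to ℓ(R̄/R).
    rw [add_comm 1, add_right_comm, add_comm (cmType R Q)]
    exact (ENat.add_left_injective_of_ne_top ENat.one_ne_top).eq_iff
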